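/- Let $(\Omega,\mathcal F,\mathbb P)$ be a probability space and let $\{X(t)\}_{t\in\mathbb R}$ be a real-valued centered Gaussian process on it whose trajectories are, with probability $1$, continuous and nowhere differentiable functions on $\mathbb R$ (that is, differentiable at no point). For a compact interval $J=[u,v]$ with $u<v$ and $\omega\in\Omega$, define the uniform Hölder exponent of the trajectory on $J$ and a deterministic exponent by $$\beta_X(J,\omega)=\sup\Big\{\beta\ge 0:\ \sup_{t',t''\in J,\ t'\ne t''}\frac{|X(t',\omega)-X(t'',\omega)|}{|t'-t''|^{\beta}}<\infty\Big\},$$ $$b_X(J)=\sup\Big\{b\ge 0:\ \sup_{t',t''\in J,\ t'\ne t''}\frac{\mathbb E|X(t')-X(t'')|^2}{|t'-t''|^{2b}}<\infty\Big\},$$ and, for $s\in\mathbb R$, define the local Hölder exponent of the trajectory at $s$ and its deterministic counterpart by $$\widetilde\alpha_X(s,\omega)=\sup\{\beta_X([u,v],\omega):\ u,v\in\mathbb R,\ s\in(u,v)\},\qquad \widetilde a_X(s)=\sup\{b_X([u,v]):\ u,v\in\mathbb R,\ s\in(u,v)\}.$$ All exponents are suprema in $[0,\infty]$ (with $\sup\emptyset=0$).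 Then: (i) For every compact interval $J=[u,v]$ with $u<v$, $\mathbb P\{\beta_X(J)=b_X(J)\}=1$. (ii) There is an event $\widetilde\Omega$ with $\mathbb P(\widetilde\Omega)=1$, not depending on $s$, such that $\widetilde\alpha_X(s,\omega)=\widetilde a_X(s)$ for all $(s,\omega)\in\mathbb R\times\widetilde\Omega$. -/

import Mathlib

open MeasureTheory ProbabilityTheory Set
open scoped NNReal ENNReal

noncomputable section

namespace GaussianHolder

/-- The uniform Hölder exponent on `J` of a function `f`, as an element of `[0, ∞]`: the supremum
of the `β ≥ 0` for which `|f t' - f t''| / |t' - t''| ^ β` is bounded over `t' ≠ t''` in `J`. -/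
def uniformExponent (f : ℝ → ℝ) (J : Set ℝ) : ℝ≥0∞ :=
  ⨆ (β : ℝ≥0) (_ : BddAbove {r : ℝ | ∃ t' ∈ J, ∃ t'' ∈ J, t' ≠ t'' ∧
    r = |f t' - f t''| / |t' - t''| ^ (β : ℝ)}), (β : ℝ≥0∞)

/-- The local Hölder exponent of a function `f` at the point `s`: the supremum of the uniform
exponents of `f` over the compact intervals `[u, v]` with `s ∈ (u, v)`. -/
def localExponent (f : ℝ → ℝ) (s : ℝ) : ℝ≥0∞ :=
  ⨆ (u : ℝ) (v : ℝ) (_ : s ∈ Ioo u v), uniformExponent f (Icc u v)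

variable {Ω : Type*} [MeasurableSpace Ω]

/-- The deterministic exponent of a process `X` on `J`: the supremum in `[0, ∞]` of the `b ≥ 0`
for which `𝔼|X(t') - X(t'')|² / |t' - t''| ^ (2 b)` is bounded over `t' ≠ t''` in `J`. -/
def incrementExponent (X : ℝ → Ω → ℝ) (P : Measure Ω) (J : Set ℝ) : ℝ≥0∞ :=
  ⨆ (b : ℝ≥0) (_ : BddAbove {r : ℝ | ∃ t' ∈ J, ∃ t'' ∈ J, t' ≠ t'' ∧
    r = (∫ ω, |X t' ω - X t'' ω| ^ 2 ∂P) / |t' - t''| ^ (2 * (b : ℝ))}), (b : ℝ≥0∞)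

/-- The localized deterministic exponent of `X` at `s`: the supremum of the deterministic
exponents of `X` over the compact intervals `[u, v]` with `s ∈ (u, v)`. -/
def localIncrementExponent (X : ℝ → Ω → ℝ) (P : Measure Ω) (s : ℝ) : ℝ≥0∞ :=
  ⨆ (u : ℝ) (v : ℝ) (_ : s ∈ Ioo u v), incrementExponent X P (Icc u v)

end GaussianHolder

end

/-! A centered Gaussian increment is governed by its variance alone, and this links the two
exponents in both directions. If the variance is at most `C |s - t| ^ (2 b)`, every moment of order
`p` is at most a constant times `|s - t| ^ (b p)`. Kolmogorov's criterion with `p` large then gives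
`β`-Hölder paths for each `β < b` (`ae_holder_of_variance_le`). Conversely, if the paths are
`β`-Hölder with positive outer probability, some constant `n` serves on a set of outer probability
`ε > 0`. A Gaussian variable bounded by `M` with probability at least `ε` has standard deviation at
most a multiple of `M / ε`, so the variance bound holds (`variance_le_of_not_ae_not_holder`). No
zero-one law is needed. Testing rational exponents gives (i). For (ii), monotonicity in the interval
reduces local exponents to intervals with rational end points, so a single null set serves every
`s`. -/

namespace GaussianHolder

/-! ### Hölder bounds for real functions and dyadic chaining. -/

section Deterministic

lemma bddAbove_quotient_iff {g : ℝ → ℝ → ℝ} {J : Set ℝ} {p : ℝ} :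
    BddAbove {r : ℝ | ∃ t' ∈ J, ∃ t'' ∈ J, t' ≠ t'' ∧ r = g t' t'' / |t' - t''| ^ p} ↔
      ∃ K : ℝ, 0 ≤ K ∧ ∀ s ∈ J, ∀ t ∈ J, s ≠ t → g s t ≤ K * |s - t| ^ p := by
  have hpos : ∀ s t : ℝ, s ≠ t → 0 < |s - t| ^ p := fun s t h =>
    Real.rpow_pos_of_pos (abs_pos.2 (sub_ne_zero.2 h)) _
  constructor
  · rintro ⟨K, hK⟩
    refine ⟨max K 0, le_max_right _ _, fun s hs t ht hst => ?_⟩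
    rw [← div_le_iff₀ (hpos s t hst)]
    exact (hK ⟨s, hs, t, ht, hst, rfl⟩).trans (le_max_left _ _)
  · rintro ⟨K, -, hK⟩
    refine ⟨K, ?_⟩
    rintro r ⟨s, hs, t, ht, hst, rfl⟩
    rw [div_le_iff₀ (hpos s t hst)]
    exact hK s hs t ht hst

/-- On a bounded interval the surplus factor `|s - t| ^ (q - p)` is at most `(v - u) ^ (q - p)`, so
admissible Hölder exponents are closed downwards. -/
lemma le_rpow_abs_sub_of_le {u v K p q a s t : ℝ} (hK : 0 ≤ K) (hpq : p ≤ q)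
    (hs : s ∈ Icc u v) (ht : t ∈ Icc u v) (hst : s ≠ t) (h : a ≤ K * |s - t| ^ q) :
    a ≤ K * (v - u) ^ (q - p) * |s - t| ^ p := by
  have h0 : 0 < |s - t| := abs_pos.2 (sub_ne_zero.2 hst)
  have h1 : |s - t| ≤ v - u := by
    rw [abs_le]; constructor <;> linarith [hs.1, hs.2, ht.1, ht.2]
  have h2 : |s - t| ^ q = |s - t| ^ (q - p) * |s - t| ^ p := by
    rw [← Real.rpow_add h0]; ring_nf
  rw [h2] at h
  refine h.trans ?_
  rw [mul_assoc]
  have := Real.rpow_le_rpow h0.le h1 (sub_nonneg.2 hpq)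
  gcongr

lemma uniformExponent_anti {f : ℝ → ℝ} {I J : Set ℝ} (h : I ⊆ J) :
    uniformExponent f J ≤ uniformExponent f I := by
  refine iSup_mono fun β => iSup_le fun hb => le_iSup_of_le (hb.mono ?_) le_rfl
  rintro r ⟨s, hs, t, ht, hst, rfl⟩
  exact ⟨s, h hs, t, h ht, hst, rfl⟩

lemma incrementExponent_anti {Ω : Type*} [MeasurableSpace Ω] {X : ℝ → Ω → ℝ} {P : Measure Ω}
    {I J : Set ℝ} (h : I ⊆ J) : incrementExponent X P J ≤ incrementExponent X P I := by
  refine iSup_mono fun β => iSup_le fun hb => le_iSup_of_le (hb.mono ?_) le_rfl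
  rintro r ⟨s, hs, t, ht, hst, rfl⟩
  exact ⟨s, h hs, t, h ht, hst, rfl⟩

/-- A monotone interval exponent has the same supremum over the open intervals around `s` and over
those with rational end points. -/
lemma iSup_Icc_eq_iSup_rat {e : Set ℝ → ℝ≥0∞} (he : ∀ I J : Set ℝ, I ⊆ J → e J ≤ e I) (s : ℝ) :
    (⨆ (u : ℝ) (v : ℝ) (_ : s ∈ Ioo u v), e (Icc u v)) =
      ⨆ (u : ℚ) (v : ℚ) (_ : s ∈ Ioo (u : ℝ) (v : ℝ)), e (Icc (u : ℝ) (v : ℝ)) := by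
  apply le_antisymm
  · refine iSup_le fun u => iSup_le fun v => iSup_le fun hs => ?_
    obtain ⟨u', hu, hu'⟩ := exists_rat_btwn hs.1
    obtain ⟨v', hv', hv⟩ := exists_rat_btwn hs.2
    exact le_iSup_of_le u' (le_iSup_of_le v' (le_iSup_of_le ⟨hu', hv'⟩
      (he _ _ (Icc_subset_Icc hu.le hv.le))))
  · exact iSup_le fun u => iSup_le fun v => iSup_le fun hs =>
      le_iSup_of_le (u : ℝ) (le_iSup_of_le (v : ℝ) (le_iSup_of_le hs le_rfl))

/-- The left dyadic approximation of order `n` of a point. -/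
noncomputable def dyadicFloor (n : ℕ) (s : ℝ) : ℝ := (⌊2 ^ n * s⌋₊ : ℝ) / 2 ^ n

lemma dyadicFloor_le {n : ℕ} {s : ℝ} (hs : 0 ≤ s) : dyadicFloor n s ≤ s := by
  rw [dyadicFloor, div_le_iff₀ (by positivity), mul_comm]
  exact Nat.floor_le (by positivity)

lemma lt_dyadicFloor_add (n : ℕ) (s : ℝ) : s < dyadicFloor n s + (1 / 2) ^ n := by
  have h := Nat.lt_floor_add_one (2 ^ n * s)
  rw [dyadicFloor, one_div, inv_pow, ← one_div, ← add_div, lt_div_iff₀ (by positivity), mul_comm]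
  exact h

lemma tendsto_dyadicFloor {s : ℝ} (hs : 0 ≤ s) :
    Filter.Tendsto (fun n => dyadicFloor n s) Filter.atTop (nhds s) := by
  have h : Filter.Tendsto (fun n : ℕ => s - (1 / 2 : ℝ) ^ n) Filter.atTop (nhds (s - 0)) :=
    tendsto_const_nhds.sub (tendsto_pow_atTop_nhds_zero_of_lt_one (by norm_num) (by norm_num))
  rw [sub_zero] at h
  exact tendsto_of_tendsto_of_tendsto_of_le_of_le h tendsto_const_nhds
    (fun n => by have := lt_dyadicFloor_add n s; dsimp only; linarith)
    (fun n => dyadicFloor_le hs)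

lemma abs_sub_le_of_le_succ {f : ℝ → ℝ} {c : ℝ} {n j k : ℕ} (hc : 0 ≤ c)
    (h : ∀ k : ℕ, k + 1 ≤ 2 ^ n → |f ((k + 1 : ℕ) / 2 ^ n) - f (k / 2 ^ n)| ≤ c)
    (hjk : j ≤ k) (hkj : k ≤ j + 1) (hk : k ≤ 2 ^ n) :
    |f (k / 2 ^ n) - f (j / 2 ^ n)| ≤ c := by
  rcases Nat.lt_or_ge j k with hlt | hge
  · obtain rfl : k = j + 1 := by omega
    exact h j hk
  · obtain rfl : k = j := by omega
    simpa using hc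

lemma floor_two_pow_mul_le {n : ℕ} {s : ℝ} (hs1 : s ≤ 1) : ⌊2 ^ n * s⌋₊ ≤ 2 ^ n := by
  refine Nat.floor_le_of_le ?_
  push_cast
  exact mul_le_of_le_one_right (by positivity) hs1

/-- Over the denominator `2 ^ (n + 1)`, the numerator of the finer approximation is twice that of
the coarser one, or one more; at most one dyadic increment separates them. -/
lemma abs_sub_dyadicFloor_succ_le {f : ℝ → ℝ} {c s : ℝ} {n : ℕ} (hc : 0 ≤ c)
    (h : ∀ k : ℕ, k + 1 ≤ 2 ^ (n + 1) →
      |f ((k + 1 : ℕ) / 2 ^ (n + 1)) - f (k / 2 ^ (n + 1))| ≤ c)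
    (hs : s ∈ Icc (0 : ℝ) 1) :
    |f (dyadicFloor (n + 1) s) - f (dyadicFloor n s)| ≤ c := by
  have h0 : (0 : ℝ) ≤ 2 ^ n * s := mul_nonneg (by positivity) hs.1
  have e : dyadicFloor n s = ((2 * ⌊2 ^ n * s⌋₊ : ℕ) : ℝ) / 2 ^ (n + 1) := by
    rw [dyadicFloor, pow_succ]; push_cast; field_simp
  rw [e, dyadicFloor]
  have h1 := Nat.floor_le h0
  have h2 := Nat.lt_floor_add_one ((2 : ℝ) ^ n * s)
  refine abs_sub_le_of_le_succ hc h ?_ ?_ (floor_two_pow_mul_le hs.2)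
  · refine Nat.le_floor ?_
    push_cast; rw [pow_succ]; linarith
  · refine Nat.lt_succ_iff.1 ((Nat.floor_lt (mul_nonneg (by positivity) hs.1)).2 ?_)
    push_cast; rw [pow_succ]; linarith

/-- Chaining: the successive approximations of `s` contribute a geometric series, and continuity of
`f` identifies the limit. -/
lemma abs_sub_dyadicFloor_le {f : ℝ → ℝ} (hf : Continuous f) {K r s : ℝ} (hK : 0 ≤ K)
    (hr0 : 0 < r) (hr1 : r < 1)
    (h : ∀ n k : ℕ, k + 1 ≤ 2 ^ n → |f ((k + 1 : ℕ) / 2 ^ n) - f (k / 2 ^ n)| ≤ K * r ^ n)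
    (hs : s ∈ Icc (0 : ℝ) 1) (n : ℕ) :
    |f s - f (dyadicFloor n s)| ≤ K / (1 - r) * r ^ n := by
  have hr : 0 < 1 - r := by linarith
  have step : ∀ m, |f (dyadicFloor (n + m) s) - f (dyadicFloor n s)| ≤
      K / (1 - r) * (r ^ n - r ^ (n + m)) := by
    intro m
    induction m with
    | zero => simp
    | succ m ih =>
      have h1 := abs_sub_dyadicFloor_succ_le (n := n + m) (by positivity) (h (n + m + 1)) hs
      have h2 : K * r ^ (n + m + 1) ≤ K / (1 - r) * (r ^ (n + m) - r ^ (n + m + 1)) := by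
        have : K / (1 - r) * (r ^ (n + m) - r ^ (n + m + 1)) = K * r ^ (n + m) := by
          field_simp; ring
        rw [this, pow_succ]
        have : 0 ≤ K * r ^ (n + m) := by positivity
        nlinarith
      calc _ ≤ |f (dyadicFloor (n + m + 1) s) - f (dyadicFloor (n + m) s)| +
            |f (dyadicFloor (n + m) s) - f (dyadicFloor n s)| := abs_sub_le _ _ _
        _ ≤ K / (1 - r) * (r ^ (n + m) - r ^ (n + m + 1)) +
            K / (1 - r) * (r ^ n - r ^ (n + m)) := add_le_add (h1.trans h2) ih
        _ = _ := by rw [← add_assoc]; ring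
  have lim : Filter.Tendsto (fun m => |f (dyadicFloor (n + m) s) - f (dyadicFloor n s)|)
      Filter.atTop (nhds |f s - f (dyadicFloor n s)|) := by
    have h1 : Filter.Tendsto (fun m => dyadicFloor (n + m) s) Filter.atTop (nhds s) := by
      simpa only [add_comm] using (Filter.tendsto_add_atTop_iff_nat n).2 (tendsto_dyadicFloor hs.1)
    exact (((hf.tendsto s).comp h1).sub_const _).abs
  refine le_of_tendsto' lim fun m => (step m).trans ?_
  have : 0 ≤ r ^ (n + m) := by positivity
  have : 0 ≤ K / (1 - r) := by positivity
  gcongr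
  linarith

/-- A continuous function whose dyadic increments of order `n` are at most `K * (2 ^ (-β)) ^ n` is
`β`-Hölder on the unit interval. -/
lemma holder_of_dyadic_increments {f : ℝ → ℝ} (hf : Continuous f) {K β : ℝ} (hK : 0 ≤ K)
    (hβ : 0 < β)
    (h : ∀ n k : ℕ, k + 1 ≤ 2 ^ n →
      |f ((k + 1 : ℕ) / 2 ^ n) - f (k / 2 ^ n)| ≤ K * ((2 : ℝ) ^ (-β)) ^ n) :
    ∃ C : ℝ, 0 ≤ C ∧ ∀ s ∈ Icc (0 : ℝ) 1, ∀ t ∈ Icc (0 : ℝ) 1, |f s - f t| ≤ C * |s - t| ^ β := by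
  set r : ℝ := 2 ^ (-β) with hr
  have hr0 : 0 < r := by positivity
  have hr1 : r < 1 := Real.rpow_lt_one_of_one_lt_of_neg (by norm_num) (by linarith)
  have hr' : 0 < 1 - r := by linarith
  set C : ℝ := (K / (1 - r) + K + K / (1 - r)) / r with hC
  have hC0 : 0 ≤ C := by positivity
  have key : ∀ s ∈ Icc (0 : ℝ) 1, ∀ t ∈ Icc (0 : ℝ) 1, s < t → |f t - f s| ≤ C * (t - s) ^ β := by
    intro s hs t ht hst
    -- With `(1/2) ^ (n + 1) < t - s ≤ (1/2) ^ n`, the approximations of order `n` are equal or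
    -- adjacent. The lower bound, being of order `n + 1`, costs the division by `r` in `C`.
    obtain ⟨n, hn, hn'⟩ := exists_nat_pow_near_of_lt_one (x := t - s) (y := 1 / 2) (by linarith)
      (by linarith [hs.1, ht.2]) (by norm_num) (by norm_num)
    have hmid : |f (dyadicFloor n t) - f (dyadicFloor n s)| ≤ K * r ^ n := by
      have h0 : (0 : ℝ) ≤ 2 ^ n * s := mul_nonneg (by positivity) hs.1
      have h0' : (0 : ℝ) ≤ 2 ^ n * t := mul_nonneg (by positivity) ht.1
      refine abs_sub_le_of_le_succ (by positivity) (h n) (Nat.floor_mono (by gcongr)) ?_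
        (floor_two_pow_mul_le ht.2)
      refine Nat.lt_succ_iff.1 ((Nat.floor_lt h0').2 ?_)
      have h2 := Nat.lt_floor_add_one ((2 : ℝ) ^ n * s)
      have h3 : (2 : ℝ) ^ n * (t - s) ≤ 2 ^ n * (1 / 2) ^ n := by gcongr
      rw [← mul_pow] at h3
      norm_num at h3
      push_cast
      linarith
    have hs' := abs_sub_dyadicFloor_le hf hK hr0 hr1 h hs n
    have ht' := abs_sub_dyadicFloor_le hf hK hr0 hr1 h ht n
    rw [abs_sub_comm] at hs'
    have hrn : r ^ n ≤ (t - s) ^ β / r := by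
      rw [le_div_iff₀ hr0, ← pow_succ, hr, Real.rpow_neg (by norm_num),
        ← Real.inv_rpow (by norm_num), ← one_div, Real.rpow_pow_comm (by norm_num)]
      exact Real.rpow_le_rpow (by positivity) hn.le hβ.le
    calc |f t - f s| ≤ |f t - f (dyadicFloor n t)| + |f (dyadicFloor n t) - f s| := abs_sub_le _ _ _
      _ ≤ |f t - f (dyadicFloor n t)| + (|f (dyadicFloor n t) - f (dyadicFloor n s)| +
            |f (dyadicFloor n s) - f s|) := by gcongr; exact abs_sub_le _ _ _
      _ ≤ K / (1 - r) * r ^ n + (K * r ^ n + K / (1 - r) * r ^ n) := by gcongr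
      _ = (K / (1 - r) + K + K / (1 - r)) * r ^ n := by ring
      _ ≤ (K / (1 - r) + K + K / (1 - r)) * ((t - s) ^ β / r) := by gcongr
      _ = C * (t - s) ^ β := by rw [hC]; ring
  refine ⟨C, hC0, fun s hs t ht => ?_⟩
  rcases lt_trichotomy s t with hst | rfl | hst
  · rw [abs_sub_comm, abs_sub_comm s t, abs_of_pos (sub_pos.2 hst)]
    exact key s hs t ht hst
  · simpa using by positivity
  · rw [abs_of_pos (sub_pos.2 hst)]
    exact key t ht s hs hst

end Deterministic

/-! ### Moments and small-ball probabilities of one centered Gaussian variable. -/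

section Gaussian

variable {Ω : Type*} [MeasurableSpace Ω] {P : Measure Ω} {Z : Ω → ℝ}

lemma map_eq_gaussianReal_of_centered (hZ : HasGaussianLaw Z P) (h0 : ∫ ω, Z ω ∂P = 0) :
    P.map Z = gaussianReal 0 (∫ ω, |Z ω| ^ 2 ∂P).toNNReal := by
  have := hZ.map_eq_gaussianReal
  rw [h0, variance_of_integral_eq_zero hZ.aemeasurable h0] at this
  simpa only [sq_abs] using this

/-- The moments of a centered Gaussian variable are controlled by its variance. -/
lemma lintegral_enorm_pow_le_of_variance_le (hZ : HasGaussianLaw Z P) (h0 : ∫ ω, Z ω ∂P = 0)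
    {σ : ℝ} (hσ : 0 ≤ σ) (hv : ∫ ω, |Z ω| ^ 2 ∂P ≤ σ ^ 2) (p : ℕ) :
    ∫⁻ ω, ‖Z ω‖ₑ ^ p ∂P ≤
      (∫⁻ x, ‖x‖ₑ ^ p ∂(gaussianReal 0 1)) * ENNReal.ofReal σ ^ p := by
  set v : ℝ := ∫ ω, |Z ω| ^ 2 ∂P with hvdef
  have hv0 : 0 ≤ v := integral_nonneg fun ω => by positivity
  -- `Z` is distributed as `√v` times a standard normal, including the degenerate case `v = 0`.
  have hlaw : P.map Z = (gaussianReal 0 1).map (√v * ·) := by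
    rw [map_eq_gaussianReal_of_centered hZ h0, gaussianReal_map_const_mul]
    congr 1
    · simp
    · ext; rw [← hvdef]; simp [Real.sq_sqrt hv0, hv0]
  have hm : Measurable fun x : ℝ => ‖x‖ₑ ^ p := by fun_prop
  rw [← lintegral_map' hm.aemeasurable hZ.aemeasurable, hlaw,
    lintegral_map hm (by fun_prop)]
  simp_rw [enorm_mul, mul_pow]
  rw [lintegral_const_mul _ hm, mul_comm]
  gcongr
  rw [Real.enorm_eq_ofReal (Real.sqrt_nonneg _)]
  exact ENNReal.ofReal_le_ofReal (Real.sqrt_le_left hσ |>.2 hv)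

lemma lintegral_enorm_pow_gaussianReal_lt_top (p : ℕ) :
    ∫⁻ x, ‖x‖ₑ ^ p ∂(gaussianReal 0 1) < ∞ := by
  have h := (memLp_id_gaussianReal (μ := 0) (v := 1) (p : ℝ≥0)).integrable_norm_pow'
  simpa [HasFiniteIntegral, enorm_pow] using h.2

/-- A centered Gaussian variable that is bounded by `M` with probability at least `ε` has variance
at most `4 M ^ 2 / (2 π ε ^ 2)`. -/
lemma variance_le_of_le_measure_abs_le (hZ : HasGaussianLaw Z P) (h0 : ∫ ω, Z ω ∂P = 0)
    {M ε : ℝ} (hM : 0 ≤ M) (hε : 0 < ε) (h : ENNReal.ofReal ε ≤ P {ω | |Z ω| ≤ M}) :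
    ∫ ω, |Z ω| ^ 2 ∂P ≤ (2 * M) ^ 2 / (2 * Real.pi * ε ^ 2) := by
  set v : ℝ := ∫ ω, |Z ω| ^ 2 ∂P with hvdef
  have hlaw := map_eq_gaussianReal_of_centered hZ h0
  rw [← hvdef] at hlaw
  rcases le_or_gt v 0 with hv | hv
  · exact hv.trans (by positivity)
  have hset : {ω | |Z ω| ≤ M} = Z ⁻¹' Icc (-M) M := by ext; simp [abs_le]
  have hvne : v.toNNReal ≠ 0 := by simpa using hv
  rw [hset, ← Measure.map_apply_of_aemeasurable hZ.aemeasurable measurableSet_Icc, hlaw,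
    gaussianReal_apply _ hvne] at h
  -- The density is at most its value at the mean, whence `ε ≤ 2 M / √(2 π v)`.
  have hb : ∀ x, gaussianPDF 0 v.toNNReal x ≤ ENNReal.ofReal (√(2 * Real.pi * v))⁻¹ := by
    intro x
    rw [gaussianPDF, gaussianPDFReal]
    apply ENNReal.ofReal_le_ofReal
    rw [Real.coe_toNNReal _ hv.le]
    refine mul_le_of_le_one_right (by positivity) (Real.exp_le_one_iff.2 ?_)
    rw [neg_div, neg_nonpos]; positivity
  have h1 : ENNReal.ofReal ε ≤ ENNReal.ofReal ((√(2 * Real.pi * v))⁻¹ * (2 * M)) := by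
    refine h.trans ((lintegral_mono hb).trans ?_)
    rw [setLIntegral_const, Real.volume_Icc, ← ENNReal.ofReal_mul (by positivity)]
    exact ENNReal.ofReal_le_ofReal (by gcongr; linarith)
  rw [ENNReal.ofReal_le_ofReal_iff (by positivity)] at h1
  have hs : 0 < √(2 * Real.pi * v) := by positivity
  rw [inv_mul_eq_div, le_div_iff₀ hs] at h1
  have h2 : (ε * √(2 * Real.pi * v)) ^ 2 ≤ (2 * M) ^ 2 := by gcongr
  rw [mul_pow, Real.sq_sqrt (by positivity)] at h2
  rw [le_div_iff₀ (by positivity)]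
  linarith

end Gaussian

/-! ### Path regularity against variance of increments. -/

section Paths

variable {Ω : Type*} [MeasurableSpace Ω] {P : Measure Ω}

/-- Kolmogorov's continuity criterion on the unit interval, for a process with continuous paths. -/
lemma ae_holder_of_moment_le {Y : ℝ → Ω → ℝ} (hm : ∀ t, AEMeasurable (Y t) P)
    (hc : ∀ᵐ ω ∂P, Continuous fun t => Y t ω) {p : ℕ} (hp : p ≠ 0) {q β : ℝ} {M : ℝ≥0∞}
    (hM : M ≠ ∞) (hβ : 0 < β) (hq : 1 + β * p < q)
    (h : ∀ s ∈ Icc (0 : ℝ) 1, ∀ t ∈ Icc (0 : ℝ) 1,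
      ∫⁻ ω, ‖Y s ω - Y t ω‖ₑ ^ p ∂P ≤ M * ENNReal.ofReal (|s - t| ^ q)) :
    ∀ᵐ ω ∂P, ∃ C : ℝ, 0 ≤ C ∧ ∀ s ∈ Icc (0 : ℝ) 1, ∀ t ∈ Icc (0 : ℝ) 1,
      |Y s ω - Y t ω| ≤ C * |s - t| ^ β := by
  set R : ℝ≥0∞ := ENNReal.ofReal (2 ^ β) with hR
  -- Each dyadic increment is rescaled by `2 ^ (β n)`, so a bound on `D` uniform in `n` and `k` is
  -- the hypothesis of `holder_of_dyadic_increments`.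
  set D : ℕ → ℕ → Ω → ℝ≥0∞ := fun n k ω =>
    (R ^ n * ‖Y ((k + 1 : ℕ) / 2 ^ n) ω - Y (k / 2 ^ n) ω‖ₑ) ^ p with hD
  have hDm : ∀ n k, AEMeasurable (D n k) P := fun n k =>
    ((((hm _).sub (hm _)).enorm).const_mul _).pow_const _
  have hDint : ∀ n k, k < 2 ^ n →
      ∫⁻ ω, D n k ω ∂P ≤ (R ^ n) ^ p * (M * ENNReal.ofReal (2 ^ (-q)) ^ n) := by
    intro n k hk
    simp only [hD, mul_pow]
    have hme : AEMeasurable (fun ω => ‖Y ((k + 1 : ℕ) / 2 ^ n) ω - Y (k / 2 ^ n) ω‖ₑ ^ p) P :=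
      ((hm _).sub (hm _)).enorm.pow_const _
    rw [lintegral_const_mul'' _ hme]
    gcongr
    have hk' : (k : ℝ) + 1 ≤ 2 ^ n := by exact_mod_cast hk
    refine (h _ ⟨by positivity, ?_⟩ _ ⟨by positivity, ?_⟩).trans (le_of_eq ?_)
    · rw [div_le_one (by positivity)]; push_cast; exact hk'
    · rw [div_le_one (by positivity)]; linarith
    · congr 1
      rw [← ENNReal.ofReal_pow (by positivity), ← sub_div]
      congr 1
      push_cast
      rw [add_sub_cancel_left, abs_of_pos (by positivity), one_div, Real.inv_rpow (by positivity),
        ← Real.rpow_natCast, ← Real.rpow_natCast, ← Real.rpow_mul (by norm_num),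
        ← Real.rpow_mul (by norm_num), ← Real.rpow_neg (by norm_num)]
      ring_nf
  -- Order `n` has `2 ^ n` increments, with total expectation at most `M * ρ ^ n`, where `ρ = 2 ^ (1
  -- + β p - q)`.
  set ρ : ℝ≥0∞ := 2 * R ^ p * ENNReal.ofReal (2 ^ (-q)) with hρ
  have hρ1 : ρ < 1 := by
    have : ρ = ENNReal.ofReal (2 ^ (1 + β * p - q)) := by
      have h2 : (2 : ℝ≥0∞) = ENNReal.ofReal 2 := by simp
      rw [hρ, hR, h2, ← ENNReal.ofReal_pow (by positivity), ← ENNReal.ofReal_mul (by positivity),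
        ← ENNReal.ofReal_mul (by positivity), ← Real.rpow_natCast, ← Real.rpow_mul (by norm_num),
        sub_eq_add_neg, Real.rpow_add (by norm_num), Real.rpow_add (by norm_num), Real.rpow_one]
    rw [this, ENNReal.ofReal_lt_one]
    exact Real.rpow_lt_one_of_one_lt_of_neg (by norm_num) (by linarith)
  have hsum : ∫⁻ ω, ∑' n, ∑ k ∈ Finset.range (2 ^ n), D n k ω ∂P ≠ ∞ := by
    rw [lintegral_tsum fun n => Finset.aemeasurable_fun_sum _ fun k _ => hDm n k]
    refine ne_top_of_le_ne_top (b := M * (1 - ρ)⁻¹) ?_ ?_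
    · exact ENNReal.mul_ne_top hM (ENNReal.inv_ne_top.2 (tsub_pos_of_lt hρ1).ne')
    · rw [← ENNReal.tsum_geometric, ← ENNReal.tsum_mul_left]
      refine ENNReal.tsum_le_tsum fun n => ?_
      rw [lintegral_finsetSum' _ fun k _ => hDm n k]
      refine (Finset.sum_le_sum fun k hk => hDint n k (Finset.mem_range.1 hk)).trans (le_of_eq ?_)
      rw [Finset.sum_const, Finset.card_range, nsmul_eq_mul, hρ]
      push_cast
      ring
  have hae := ae_lt_top' (AEMeasurable.tsum fun n =>
    Finset.aemeasurable_fun_sum _ fun k _ => hDm n k) hsum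
  filter_upwards [hae, hc] with ω hω hcω
  set S : ℝ≥0∞ := ∑' n, ∑ k ∈ Finset.range (2 ^ n), D n k ω with hS
  have hle : ∀ n k, k < 2 ^ n → D n k ω ≤ S := fun n k hk =>
    (Finset.single_le_sum (f := fun k => D n k ω) (fun _ _ => zero_le)
      (Finset.mem_range.2 hk)).trans
      (ENNReal.le_tsum (f := fun n => ∑ k ∈ Finset.range (2 ^ n), D n k ω) n)
  -- The maximum with `1` avoids a `p`-th root: `x ^ p ≤ S` forces `x ≤ max 1 S`.
  refine holder_of_dyadic_increments hcω (K := max 1 S.toReal) (by positivity) hβ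
    fun n k hk => ?_
  have h1 := ENNReal.toReal_mono hω.ne (hle n k hk)
  simp only [hD, hR] at h1
  rw [ENNReal.toReal_pow, ENNReal.toReal_mul, ENNReal.toReal_pow,
    ENNReal.toReal_ofReal (by positivity), toReal_enorm, Real.norm_eq_abs] at h1
  set a : ℝ := |Y ((k + 1 : ℕ) / 2 ^ n) ω - Y (k / 2 ^ n) ω| with ha
  have h2 : (2 ^ β) ^ n * a ≤ max 1 S.toReal := by
    rcases le_total ((2 ^ β) ^ n * a) 1 with hle1 | hge1
    · exact hle1.trans (le_max_left _ _)
    · exact ((le_self_pow₀ hge1 hp).trans h1).trans (le_max_right _ _)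
  rw [Real.rpow_neg (by norm_num), inv_pow, ← div_eq_mul_inv, le_div_iff₀ (by positivity), mul_comm]
  exact h2

variable {X : ℝ → Ω → ℝ} {u v : ℝ}

/-- A centered Gaussian process with continuous paths whose increments have variance at most
`C |s - t| ^ (2 b)` on an interval has `β`-Hölder paths there for every `β < b`. -/
lemma ae_holder_of_variance_le (hG : IsGaussianProcess X P) (h0 : ∀ t, ∫ ω, X t ω ∂P = 0)
    (hc : ∀ᵐ ω ∂P, Continuous fun t => X t ω) (huv : u < v) {C b β : ℝ} (hC : 0 ≤ C)
    (hβ : 0 < β) (hβb : β < b)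
    (h : ∀ s ∈ Icc u v, ∀ t ∈ Icc u v, s ≠ t →
      ∫ ω, |X s ω - X t ω| ^ 2 ∂P ≤ C * |s - t| ^ (2 * b)) :
    ∀ᵐ ω ∂P, ∃ K : ℝ, 0 ≤ K ∧ ∀ s ∈ Icc u v, ∀ t ∈ Icc u v, s ≠ t →
      |X s ω - X t ω| ≤ K * |s - t| ^ β := by
  have hl : 0 < v - u := sub_pos.2 huv
  -- This makes `(b - β) p > 1`, that is `1 + β p < b p`, as Kolmogorov's criterion requires with `q
  -- = b p`.
  obtain ⟨p, hp⟩ := exists_nat_gt (1 / (b - β))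
  have hbβ : 0 < b - β := sub_pos.2 hβb
  have hp0 : p ≠ 0 := by
    rintro rfl
    have : 0 < 1 / (b - β) := by positivity
    simp at hp
    linarith
  rw [div_lt_iff₀ hbβ] at hp
  -- After the affine change of parameter to the unit interval, increments have standard deviation
  -- at most `c |s - t| ^ b`.
  set c : ℝ := √C * (v - u) ^ b with hcdef
  have key := ae_holder_of_moment_le (P := P) (Y := fun t => X (u + (v - u) * t))
    (fun t => hG.aemeasurable _) (hc.mono fun ω hω => hω.comp (by fun_prop)) hp0 (q := b * p)
    (β := β) (M := (∫⁻ x, ‖x‖ₑ ^ p ∂(gaussianReal 0 1)) * ENNReal.ofReal c ^ p)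
    (ENNReal.mul_ne_top (lintegral_enorm_pow_gaussianReal_lt_top p).ne (by simp)) hβ
    (by linarith) ?_
  · filter_upwards [key] with ω hω
    obtain ⟨K, hK, hω⟩ := hω
    refine ⟨K * ((v - u) ^ β)⁻¹, by positivity, fun s hs t ht _ => ?_⟩
    have hmem : ∀ s ∈ Icc u v, (s - u) / (v - u) ∈ Icc (0 : ℝ) 1 := fun s hs =>
      ⟨div_nonneg (by linarith [hs.1]) hl.le, (div_le_one hl).2 (by linarith [hs.2])⟩
    have hlin : ∀ s, u + (v - u) * ((s - u) / (v - u)) = s := fun s => by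
      field_simp; ring
    have := hω _ (hmem s hs) _ (hmem t ht)
    simp only [hlin] at this
    rw [← sub_div, sub_sub_sub_cancel_right, abs_div, abs_of_pos hl,
      Real.div_rpow (abs_nonneg _) hl.le] at this
    refine this.trans (le_of_eq ?_)
    ring
  · intro s hs t ht
    have hmem : ∀ s ∈ Icc (0 : ℝ) 1, u + (v - u) * s ∈ Icc u v := fun s hs =>
      ⟨by nlinarith [hs.1], by nlinarith [hs.2]⟩
    rcases eq_or_ne s t with rfl | hst
    · simp [hp0]
    have hint : ∀ t, Integrable (X t) P := fun t => (hG.hasGaussianLaw_eval t).integrable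
    have hv := h _ (hmem s hs) _ (hmem t ht) (by
      intro h; exact hst (mul_left_cancel₀ hl.ne' (add_left_cancel h)))
    have habs : |u + (v - u) * s - (u + (v - u) * t)| = (v - u) * |s - t| := by
      rw [show u + (v - u) * s - (u + (v - u) * t) = (v - u) * (s - t) by ring, abs_mul,
        abs_of_pos hl]
    rw [habs] at hv
    have := lintegral_enorm_pow_le_of_variance_le (hG.hasGaussianLaw_fun_sub
      (s := u + (v - u) * s) (t := u + (v - u) * t))
      (by rw [integral_sub (hint _) (hint _), h0, h0, sub_zero]) (σ := c * |s - t| ^ b)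
      (by positivity) (hv.trans (le_of_eq ?_)) p
    · refine this.trans (le_of_eq ?_)
      rw [ENNReal.ofReal_mul (by positivity), mul_pow, mul_assoc,
        ← ENNReal.ofReal_pow (by positivity) p, Real.rpow_mul (abs_nonneg _), Real.rpow_natCast,
        ENNReal.ofReal_pow (by positivity) p, ENNReal.ofReal_pow (by positivity) p]
    · rw [hcdef, mul_pow, mul_pow, Real.sq_sqrt hC, mul_comm 2 b, Real.rpow_mul (by positivity),
        Real.mul_rpow hl.le (abs_nonneg _), Real.rpow_two]
      ring

/-- If the paths of a centered Gaussian process are `β`-Hölder on a set with positive outer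
probability, then the variance of the increments is at most `C |s - t| ^ (2 β)` there. -/
lemma variance_le_of_not_ae_not_holder [IsProbabilityMeasure P] (hG : IsGaussianProcess X P)
    (h0 : ∀ t, ∫ ω, X t ω ∂P = 0) {J : Set ℝ} {β : ℝ}
    (h : ¬ ∀ᵐ ω ∂P, ¬ ∃ K : ℝ, 0 ≤ K ∧ ∀ s ∈ J, ∀ t ∈ J, s ≠ t →
      |X s ω - X t ω| ≤ K * |s - t| ^ β) :
    ∃ C : ℝ, 0 ≤ C ∧ ∀ s ∈ J, ∀ t ∈ J, s ≠ t →
      ∫ ω, |X s ω - X t ω| ^ 2 ∂P ≤ C * |s - t| ^ (2 * β) := by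
  set A : ℕ → Set Ω := fun n =>
    {ω | ∀ s ∈ J, ∀ t ∈ J, s ≠ t → |X s ω - X t ω| ≤ n * |s - t| ^ β} with hA
  -- Countable subadditivity of the outer measure suffices, so `A n` need not be measurable. The
  -- resulting `ε` does not depend on the pair `s`, `t`.
  obtain ⟨n, hn⟩ : ∃ n, P (A n) ≠ 0 := by
    by_contra! hcon
    refine h ?_
    rw [ae_iff]
    refine measure_mono_null ?_ (measure_iUnion_null hcon)
    intro ω hω
    simp only [not_not, mem_ofPred_eq] at hω
    obtain ⟨K, -, hK⟩ := hω
    obtain ⟨n, hn⟩ := exists_nat_ge K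
    refine mem_iUnion.2 ⟨n, fun s hs t ht hst => (hK s hs t ht hst).trans ?_⟩
    gcongr
  set ε : ℝ := (P (A n)).toReal with hε
  have hε0 : 0 < ε := ENNReal.toReal_pos hn (measure_ne_top _ _)
  have hint : ∀ t, Integrable (X t) P := fun t => (hG.hasGaussianLaw_eval t).integrable
  refine ⟨(2 * n) ^ 2 / (2 * Real.pi * ε ^ 2), by positivity, fun s hs t ht hst => ?_⟩
  refine (variance_le_of_le_measure_abs_le hG.hasGaussianLaw_fun_sub
    (by rw [integral_sub (hint _) (hint _), h0, h0, sub_zero]) (M := n * |s - t| ^ β)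
    (by positivity) hε0 ?_).trans (le_of_eq ?_)
  · rw [hε, ENNReal.ofReal_toReal (measure_ne_top _ _)]
    exact measure_mono fun ω hω => hω s hs t ht hst
  · rw [mul_comm 2 β, Real.rpow_mul (abs_nonneg _), Real.rpow_two]
    ring

lemma ae_le_uniformExponent (hG : IsGaussianProcess X P) (h0 : ∀ t, ∫ ω, X t ω ∂P = 0)
    (hc : ∀ᵐ ω ∂P, Continuous fun t => X t ω) (huv : u < v) :
    ∀ᵐ ω ∂P, incrementExponent X P (Icc u v) ≤ uniformExponent (fun t => X t ω) (Icc u v) := by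
  have key : ∀ q : ℚ, ∀ᵐ ω ∂P, 0 < q → ENNReal.ofReal q < incrementExponent X P (Icc u v) →
      ENNReal.ofReal q ≤ uniformExponent (fun t => X t ω) (Icc u v) := by
    intro q
    by_cases hq : 0 < q ∧ ENNReal.ofReal q < incrementExponent X P (Icc u v)
    swap
    · exact ae_of_all _ fun ω h1 h2 => absurd ⟨h1, h2⟩ hq
    obtain ⟨hq0, hlt⟩ := hq
    have hq0' : (0 : ℝ) < q := by exact_mod_cast hq0
    simp only [incrementExponent, lt_iSup_iff] at hlt
    obtain ⟨b, hb, hlt⟩ := hlt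
    obtain ⟨C, hC, hb⟩ := (bddAbove_quotient_iff
      (g := fun s t => ∫ ω, |X s ω - X t ω| ^ 2 ∂P)).1 hb
    have hqb : (q : ℝ) < b := by
      rwa [← ENNReal.ofReal_coe_nnreal, ENNReal.ofReal_lt_ofReal_iff_of_nonneg hq0'.le] at hlt
    filter_upwards [ae_holder_of_variance_le hG h0 hc huv hC hq0' hqb hb] with ω hω _ _
    refine le_iSup₂_of_le (f := fun (β : ℝ≥0) _ => (β : ℝ≥0∞)) (q : ℝ).toNNReal ?_ le_rfl
    rw [Real.coe_toNNReal _ hq0'.le]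
    exact (bddAbove_quotient_iff (g := fun s t => |X s ω - X t ω|)).2 hω
  filter_upwards [ae_all_iff.2 key] with ω hω
  refine le_of_forall_lt fun c hc => ?_
  obtain ⟨d, hcd, hd⟩ := exists_between hc
  obtain ⟨q, hq, hdq, hqd⟩ := ENNReal.lt_iff_exists_rat_btwn.1 hcd
  have hq0 : 0 < q := by
    have : 0 < ENNReal.ofReal q := bot_le.trans_lt hdq
    exact_mod_cast ENNReal.ofReal_pos.1 this
  exact hdq.trans_le (hω q hq0 (hqd.trans hd))

/-- For each rational `q` above the deterministic exponent, `q`-Hölder paths form a null set;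
otherwise `variance_le_of_not_ae_not_holder` would make `q` admissible for the variance. -/
lemma ae_uniformExponent_le [IsProbabilityMeasure P] (hG : IsGaussianProcess X P)
    (h0 : ∀ t, ∫ ω, X t ω ∂P = 0) :
    ∀ᵐ ω ∂P, uniformExponent (fun t => X t ω) (Icc u v) ≤ incrementExponent X P (Icc u v) := by
  have key : ∀ q : ℚ, ∀ᵐ ω ∂P, 0 ≤ q → incrementExponent X P (Icc u v) < ENNReal.ofReal q →
      ¬ ∃ K : ℝ, 0 ≤ K ∧ ∀ s ∈ Icc u v, ∀ t ∈ Icc u v, s ≠ t →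
        |X s ω - X t ω| ≤ K * |s - t| ^ (q : ℝ) := by
    intro q
    by_cases hq : 0 ≤ q ∧ incrementExponent X P (Icc u v) < ENNReal.ofReal q
    swap
    · exact ae_of_all _ fun ω h1 h2 => absurd ⟨h1, h2⟩ hq
    obtain ⟨hq0, hlt⟩ := hq
    have hq0' : (0 : ℝ) ≤ q := by exact_mod_cast hq0
    suffices h : ∀ᵐ ω ∂P, ¬ ∃ K : ℝ, 0 ≤ K ∧ ∀ s ∈ Icc u v, ∀ t ∈ Icc u v, s ≠ t →
        |X s ω - X t ω| ≤ K * |s - t| ^ (q : ℝ) from h.mono fun ω hω _ _ => hω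
    by_contra hcon
    refine hlt.not_ge (le_iSup₂_of_le (f := fun (β : ℝ≥0) _ => (β : ℝ≥0∞)) (q : ℝ).toNNReal ?_
      le_rfl)
    rw [Real.coe_toNNReal _ hq0']
    exact (bddAbove_quotient_iff (g := fun s t => ∫ ω, |X s ω - X t ω| ^ 2 ∂P)).2
      (variance_le_of_not_ae_not_holder hG h0 hcon)
  filter_upwards [ae_all_iff.2 key] with ω hω
  by_contra! hlt
  obtain ⟨q, hq0, hq, hqβ⟩ := ENNReal.lt_iff_exists_rat_btwn.1 hlt
  have hq0' : (0 : ℝ) ≤ q := by exact_mod_cast hq0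
  simp only [uniformExponent, lt_iSup_iff] at hqβ
  obtain ⟨β, hβ, hqβ⟩ := hqβ
  obtain ⟨K, hK, hβ⟩ := (bddAbove_quotient_iff (g := fun s t => |X s ω - X t ω|)).1 hβ
  have hqβ' : (q : ℝ) < β := by
    change ENNReal.ofReal q < _ at hqβ
    rwa [← ENNReal.ofReal_coe_nnreal, ENNReal.ofReal_lt_ofReal_iff_of_nonneg hq0'] at hqβ
  refine hω q hq0 hq ?_
  rcases le_or_gt u v with huv | huv
  · have : 0 ≤ v - u := sub_nonneg.2 huv
    exact ⟨K * (v - u) ^ ((β : ℝ) - q), by positivity, fun s hs t ht hst =>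
      le_rpow_abs_sub_of_le hK hqβ'.le hs ht hst (hβ s hs t ht hst)⟩
  · exact ⟨0, le_rfl, fun s hs => absurd (hs.1.trans hs.2) huv.not_ge⟩

end Paths

end GaussianHolder

/-! ### The almost sure identities. -/

theorem mainTheorem3 {Ω : Type*} [MeasurableSpace Ω] (P : Measure Ω) [IsProbabilityMeasure P]
    (X : ℝ → Ω → ℝ)
    (hGauss : IsGaussianProcess X P)
    (hCentered : ∀ t : ℝ, ∫ ω, X t ω ∂P = 0)
    (hPaths : ∀ᵐ ω ∂P, Continuous (fun t : ℝ => X t ω) ∧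
      ∀ t : ℝ, ¬ DifferentiableAt ℝ (fun t : ℝ => X t ω) t) :
    (∀ u v : ℝ, u < v → ∀ᵐ ω ∂P,
      GaussianHolder.uniformExponent (fun t : ℝ => X t ω) (Icc u v) =
        GaussianHolder.incrementExponent X P (Icc u v)) ∧
    (∃ Ω' : Set Ω, MeasurableSet Ω' ∧ P Ω' = 1 ∧ ∀ s : ℝ, ∀ ω ∈ Ω',
      GaussianHolder.localExponent (fun t : ℝ => X t ω) s =
        GaussianHolder.localIncrementExponent X P s) := by
  have hc : ∀ᵐ ω ∂P, Continuous fun t => X t ω := hPaths.mono fun ω hω => hω.1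
  have main : ∀ u v : ℝ, u < v → ∀ᵐ ω ∂P,
      GaussianHolder.uniformExponent (fun t : ℝ => X t ω) (Icc u v) =
        GaussianHolder.incrementExponent X P (Icc u v) := by
    intro u v huv
    filter_upwards [GaussianHolder.ae_uniformExponent_le hGauss hCentered (u := u) (v := v),
      GaussianHolder.ae_le_uniformExponent hGauss hCentered hc huv] with ω h1 h2
    exact le_antisymm h1 h2
  refine ⟨main, ?_⟩
  have hrat : ∀ᵐ ω ∂P, ∀ u v : ℚ, (u : ℝ) < v →
      GaussianHolder.uniformExponent (fun t : ℝ => X t ω) (Icc (u : ℝ) v) =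
        GaussianHolder.incrementExponent X P (Icc (u : ℝ) v) := by
    rw [ae_all_iff]; intro u
    rw [ae_all_iff]; intro v
    by_cases huv : (u : ℝ) < v
    · exact (main u v huv).mono fun ω hω _ => hω
    · exact ae_of_all _ fun ω h => absurd h huv
  -- The exceptional set may fail to be measurable, so the event is the complement of a measurable
  -- null superset.
  obtain ⟨A, hA, hAm, hA0⟩ := exists_measurable_superset_of_null (ae_iff.1 hrat)
  refine ⟨Aᶜ, hAm.compl, (prob_compl_eq_one_iff hAm).2 hA0, fun s ω hω => ?_⟩
  have hω' := fun u v => not_not.1 (fun h => hω (hA h)) u v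
  rw [GaussianHolder.localExponent, GaussianHolder.localIncrementExponent,
    GaussianHolder.iSup_Icc_eq_iSup_rat
      (e := GaussianHolder.uniformExponent fun t : ℝ => X t ω)
      (fun _ _ => GaussianHolder.uniformExponent_anti),
    GaussianHolder.iSup_Icc_eq_iSup_rat (e := GaussianHolder.incrementExponent X P)
      (fun _ _ => GaussianHolder.incrementExponent_anti)]
  refine iSup_congr fun u => iSup_congr fun v => iSup_congr fun hs => ?_
  exact hω' u v (hs.1.trans hs.2)
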